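/- Let $\mathbf X$ be a measurable space, let $\mu,\nu$ be probability measures on $\mathbf X$ with $\nu\ll\mu$, and let $w=\frac{d\nu}{d\mu}:\mathbf X\to[0,\infty)$ be measurable. Let $K$ and $L$ be Markov kernels on $\mathbf X$ that are reversible with respect to $\mu$ and $\nu$, respectively, and Harris ergodic: $K$ (resp. $L$) is $\mu$-invariant (resp. $\nu$-invariant), $\psi$-irreducible for some maximal irreducibility measure $\psi$, and Harris recurrent. For a Markov kernel $P$ reversible with respect to a probability $\pi$ and $f\in L^2(\pi)$ write $$\mathcal E_P(f)=\langle f,(1-P)f\rangle_\pi,\qquad \pi(f)=\int f\,d\pi,\qquad \mathrm{var}_\pi(f)=\pi(f^2)-\pi(f)^2,$$ $$\mathrm{var}(P,f)=\lim_{n\to\infty}\frac1n\,\mathbb E\Big[\Big(\sum_{k=1}^n\big[f(X_k)-\pi(f)\big]\Big)^2\Big],$$ where $(X_k)_{k\ge0}$ is the stationary Markov chain with transition $P$ and $X_0\sim\pi$. Suppose that constants $\underline c,\overline c\ge 0$ satisfy $$\underline c\,\mathcal E_K(g)\le\mathcal E_L(g)\le\overline c\,\mathcal E_K(g)\quad\text{for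 all } g\in L^2(\mu),\qquad\text{and}\qquad \underline c\le w\le\overline c\quad\mu\text{-a.e.}$$ Then for every $\varphi\in L^2(\nu)$, with $\bar\varphi:=\varphi-\nu(\varphi)$, the limits defining $\mathrm{var}(K,w\bar\varphi)$ and $\mathrm{var}(L,\varphi)$ exist in $[0,\infty]$, and (with $0\cdot\infty=0$) $$\mathrm{var}(K,w\bar\varphi)+\mathrm{var}_\mu(w\bar\varphi)\le\overline c\,\big[\mathrm{var}(L,\varphi)+\mathrm{var}_\nu(\varphi)\big],$$ $$\mathrm{var}(K,w\bar\varphi)+\mathrm{var}_\mu(w\bar\varphi)\ge\underline c\,\big[\mathrm{var}(L,\varphi)+\mathrm{var}_\nu(\varphi)\big].$$ In particular, if $\nu(\varphi)=0$ then $w\bar\varphi=w\varphi$. -/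

import Mathlib

open MeasureTheory ProbabilityTheory Filter Topology

open scoped ENNReal NNReal

namespace QuasiPeskun

variable {X : Type*} [MeasurableSpace X]

/-- The `n`-th step of a time-homogeneous Markov chain with transition kernel `K`, as a kernel
reading off the present state from the history `(x₀, …, xₙ)`. -/
noncomputable def stepKernel (K : Kernel X X) (n : ℕ) :
    Kernel ((i : Finset.Iic n) → (fun _ : ℕ => X) i) X :=
  K.comap (fun h => h ⟨n, Finset.mem_Iic.2 le_rfl⟩) (measurable_pi_apply _)

instance (K : Kernel X X) [IsMarkovKernel K] (n : ℕ) : IsMarkovKernel (stepKernel K n) := by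
  unfold stepKernel; infer_instance

/-- The law on the path space `ℕ → X` of the Markov chain `(X₀, X₁, …)` with transition
kernel `K` and initial distribution `μ₀`. -/
noncomputable def chainLaw (K : Kernel X X) [IsMarkovKernel K] (μ₀ : Measure X) :
    Measure (ℕ → X) :=
  Kernel.trajMeasure (X := fun _ => X) μ₀ (stepKernel K)

/-- `ψ` is a maximal irreducibility measure of `K`: the chain is `ψ`-irreducible, and every `φ`
for which it is `φ`-irreducible is absolutely continuous with respect to `ψ`. -/
def IsMaximalIrreducibilityMeasure (K : Kernel X X) (ψ : Measure X) : Prop :=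
  Kernel.IsIrreducible ψ K ∧ ∀ φ : Measure X, Kernel.IsIrreducible φ K → φ ≪ ψ

/-- A set `A` is Harris recurrent for `K` if the chain started at any point of `A` visits `A`
infinitely often almost surely. -/
def IsHarrisRecurrentSet (K : Kernel X X) [IsMarkovKernel K] (A : Set X) : Prop :=
  ∀ x ∈ A, ∀ᵐ ω ∂(chainLaw K (Measure.dirac x)), ∃ᶠ n in atTop, ω n ∈ A

/-- `K` is `μ`-Harris ergodic: it is `μ`-invariant, `ψ`-irreducible with a (nontrivial,
normalised) maximal irreducibility measure `ψ`, and Harris recurrent, i.e. every measurable set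
of positive `ψ`-measure is Harris recurrent. -/
def IsHarrisErgodic (K : Kernel X X) [IsMarkovKernel K] (μ : Measure X) : Prop :=
  Kernel.Invariant K μ ∧
    ∃ ψ : Measure X, IsProbabilityMeasure ψ ∧ IsMaximalIrreducibilityMeasure K ψ ∧
      ∀ A : Set X, MeasurableSet A → 0 < ψ A → IsHarrisRecurrentSet K A

/-- The Dirichlet form `𝓔_K(f) = ⟨f, (1 - K) f⟩_μ`, where `K f (x) = ∫ f(y) K(x, dy)`. -/
noncomputable def dirichletForm (K : Kernel X X) (μ : Measure X) (f : X → ℝ) : ℝ :=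
  ∫ x, f x * (f x - ∫ y, f y ∂(K x)) ∂μ

/-- `var(K, f)` exists in `[0, ∞]` and equals `v`: along the stationary chain (`X₀ ∼ μ`),
`(1 / n) 𝔼[(∑ k = 1, …, n, (f(X_k) - μ(f)))²] → v` as `n → ∞`. -/
def HasAsymptoticVariance (K : Kernel X X) [IsMarkovKernel K] (μ : Measure X) (f : X → ℝ)
    (v : ℝ≥0∞) : Prop :=
  Tendsto
    (fun n : ℕ => (n : ℝ≥0∞)⁻¹ *
      ∫⁻ ω, ENNReal.ofReal ((∑ k ∈ Finset.Icc 1 n, (f (ω k) - ∫ x, f x ∂μ)) ^ 2)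
        ∂(chainLaw K μ))
    atTop (𝓝 v)

end QuasiPeskun

/-! On `L²(π)` a reversible kernel acts as a symmetric contraction `T`, and `var(P, f) + var_π(f)`
is formally `2⟨f₀, (1 - T)⁻¹ f₀⟩`, with `f₀` the centred `f`. By duality this is the supremum over
`g` of `4⟨f₀, g⟩ - 2⟨g, (1 - T) g⟩`, a formula that also makes sense when the value is infinite
(`specVar_add_norm_sq`, `exists_hasAsymptoticVariance`).

Since `⟨w φ̄, g⟩_μ = ⟨φ̄, g⟩_ν`, the formulas for `K` and `L` have the same linear term and differ
only in their Dirichlet forms and classes of test functions. Replacing `g` by a multiple of `g`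
turns the comparison of Dirichlet forms into that of the suprema, and the bounds on `w` keep the
test functions square integrable.

No spectral theorem is needed: `(1 + t)/(1 - t) = ∑ t²ᵏ (1 + t)²` writes the variance as a series of
squared norms, whose partial sums are monotone, so its limit always exists in `[0, ∞]`. -/

namespace QuasiPeskun

/-! ### Symmetric contractions: approximate resolvent and variational formula -/

section Hilbert

variable {E : Type*} [NormedAddCommGroup E] [InnerProductSpace ℝ E]

open scoped InnerProductSpace

/-- The partial sums of `V(f) = ∑ₖ ‖Tᵏ (1 + T) f‖²`, the asymptotic variance of `f`. -/
noncomputable def partialVar (T : Module.End ℝ E) (f : E) (m : ℕ) : ℝ :=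
  ∑ k ∈ Finset.range m, ‖(T ^ k) (f + T f)‖ ^ 2

/-- The polynomial `1/2 + 1/2 ∑_{k < m} T²ᵏ (1 + T)²`, an approximate inverse of `1 - T`. -/
noncomputable def approxResolvent (T : Module.End ℝ E) (m : ℕ) : Module.End ℝ E :=
  (2⁻¹ : ℝ) • (1 + ∑ k ∈ Finset.range m, T ^ (2 * k) * ((1 + T) * (1 + T)))

/-- The error term `T²ᵐ (1 + T) / 2` of `approxResolvent`. -/
noncomputable def resolventError (T : Module.End ℝ E) (m : ℕ) : Module.End ℝ E :=
  (2⁻¹ : ℝ) • (T ^ (2 * m) * (1 + T))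

/-- The sum telescopes, because `T²ᵏ (1 + T)² (1 - T) = T²ᵏ (1 + T) - T²ᵏ⁺² (1 + T)`. -/
lemma approxResolvent_mul_one_sub (T : Module.End ℝ E) (m : ℕ) :
    approxResolvent T m * (1 - T) = 1 - resolventError T m := by
  have key : (1 + ∑ k ∈ Finset.range m, T ^ (2 * k) * ((1 + T) * (1 + T))) * (1 - T)
      = (1 + 1) - T ^ (2 * m) * (1 + T) := by
    induction m with
    | zero => simp
    | succ m ih =>
      rw [Finset.sum_range_succ, ← add_assoc, add_mul, ih, mul_add 2 m 1, pow_add]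
      noncomm_ring
  rw [approxResolvent, resolventError, smul_mul_assoc, key, smul_sub]
  rw [← two_smul ℝ (1 : Module.End ℝ E), inv_smul_smul₀ two_ne_zero]

variable {T : Module.End ℝ E} (hT : T.IsSymmetric)

include hT

lemma inner_pow_add (k l : ℕ) (x y : E) :
    ⟪(T ^ (k + l)) x, y⟫_ℝ = ⟪(T ^ k) x, (T ^ l) y⟫_ℝ := by
  rw [add_comm, pow_add, Module.End.mul_apply, hT.pow l]

lemma inner_pow_two_mul (k : ℕ) (x y : E) :
    ⟪(T ^ (2 * k)) x, y⟫_ℝ = ⟪(T ^ k) x, (T ^ k) y⟫_ℝ := by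
  rw [two_mul, inner_pow_add hT]

lemma inner_one_add (x y : E) : ⟪x + T x, y⟫_ℝ = ⟪x, y + T y⟫_ℝ := by
  rw [inner_add_left, inner_add_right, hT x y]

omit hT in
lemma pow_add_apply_self (k : ℕ) (x : E) :
    (T ^ k) (x + T x) = (T ^ k) x + T ((T ^ k) x) := by
  rw [map_add, ← Module.End.mul_apply, ← Module.End.mul_apply, (Commute.pow_self T k).eq]

lemma inner_approxResolvent (m : ℕ) (x y : E) :
    ⟪approxResolvent T m x, y⟫_ℝ =
      2⁻¹ * (⟪x, y⟫_ℝ + ∑ k ∈ Finset.range m, ⟪(T ^ k) (x + T x), (T ^ k) (y + T y)⟫_ℝ) := by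
  simp only [approxResolvent, LinearMap.smul_apply, LinearMap.add_apply, Module.End.one_apply,
    LinearMap.sum_apply, real_inner_smul_left, inner_add_left, sum_inner, Module.End.mul_apply,
    inner_pow_two_mul hT]
  congr 2
  refine Finset.sum_congr rfl fun k _ => ?_
  rw [pow_add_apply_self k y, ← inner_one_add hT, ← pow_add_apply_self]

lemma inner_approxResolvent_self (m : ℕ) (x : E) :
    ⟪approxResolvent T m x, x⟫_ℝ = 2⁻¹ * (‖x‖ ^ 2 + partialVar T x m) := by
  rw [inner_approxResolvent hT]
  simp [partialVar]

lemma approxResolvent_symm (m : ℕ) (x y : E) :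
    ⟪approxResolvent T m x, y⟫_ℝ = ⟪x, approxResolvent T m y⟫_ℝ := by
  rw [← real_inner_comm x, inner_approxResolvent hT, inner_approxResolvent hT, real_inner_comm]
  simp only [real_inner_comm]

lemma inner_resolventError (m : ℕ) (x y : E) :
    ⟪resolventError T m x, y⟫_ℝ = 2⁻¹ * ⟪(T ^ m) (x + T x), (T ^ m) y⟫_ℝ := by
  simp only [resolventError, LinearMap.smul_apply, LinearMap.add_apply, Module.End.one_apply,
    real_inner_smul_left, Module.End.mul_apply, inner_pow_two_mul hT]

variable (hc : ∀ x, ‖T x‖ ≤ ‖x‖)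

include hc

omit hT in
lemma inner_one_add_nonneg (x : E) : 0 ≤ ⟪x + T x, x⟫_ℝ := by
  rw [inner_add_left, real_inner_self_eq_norm_sq]
  have h1 := neg_le_of_abs_le (abs_real_inner_le_norm (T x) x)
  nlinarith [hc x, norm_nonneg x]

/-- The error `Tᵐ (1 + T) Tᵐ / 2` is positive because `1 + T` is. The approximate resolvent is a sum
of squares of operators commuting with it, so the pairing is a sum of values of the quadratic form
of the error. -/
lemma inner_resolventError_approxResolvent_nonneg (m : ℕ) (x : E) :
    0 ≤ ⟪resolventError T m x, approxResolvent T m x⟫_ℝ := by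
  rw [real_inner_comm, inner_approxResolvent hT]
  have hcomm (z : E) : resolventError T m z + T (resolventError T m z)
      = resolventError T m (z + T z) := by
    have : Commute T (resolventError T m) :=
      ((Commute.self_pow T _).mul_right
        ((Commute.one_right _).add_right (Commute.refl T))).smul_right _
    rw [map_add, ← Module.End.mul_apply, this.eq, Module.End.mul_apply]
  have hpos (z : E) : 0 ≤ ⟪z, resolventError T m z⟫_ℝ := by
    rw [real_inner_comm, inner_resolventError hT, pow_add_apply_self]
    exact mul_nonneg (by norm_num) (inner_one_add_nonneg hc _)
  have hpow (k : ℕ) (z : E) : (T ^ k) (resolventError T m z) = resolventError T m ((T ^ k) z) := by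
    have : Commute (T ^ k) (resolventError T m) :=
      ((Commute.pow_pow_self T _ _).mul_right
        ((Commute.one_right _).add_right (Commute.pow_self T k))).smul_right _
    rw [← Module.End.mul_apply, this.eq, Module.End.mul_apply]
  refine mul_nonneg (by norm_num) (add_nonneg (hpos x) (Finset.sum_nonneg fun k _ => ?_))
  rw [hcomm, hpow]
  exact hpos _

/-- `V(f) + ‖f‖²`, truncated, is attained by the variational functional. -/
lemma norm_sq_add_partialVar_le (f : E) (m : ℕ) :
    ‖f‖ ^ 2 + partialVar T f m ≤
      4 * ⟪f, approxResolvent T m f⟫_ℝ - 2 * ⟪approxResolvent T m f,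
        approxResolvent T m f - T (approxResolvent T m f)⟫_ℝ := by
  set g := approxResolvent T m f
  -- Here `g = R f`, with `R` the approximate resolvent. Moving `R` across the inner product
  -- produces `R (1 - T) g`, which is `g` minus the error.
  have h1 : ⟪g, g - T g⟫_ℝ = ⟪g, f⟫_ℝ - ⟪resolventError T m g, f⟫_ℝ := by
    have e : approxResolvent T m (g - T g) = g - resolventError T m g := by
      simpa using congrArg (fun A : Module.End ℝ E => A g) (approxResolvent_mul_one_sub T m)
    rw [real_inner_comm, ← inner_sub_left, ← e, approxResolvent_symm hT]
  have h2 : ⟪resolventError T m g, f⟫_ℝ = ⟪resolventError T m f, g⟫_ℝ := by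
    rw [inner_resolventError hT, inner_resolventError hT, pow_add_apply_self, inner_one_add hT,
      ← pow_add_apply_self, real_inner_comm]
  have h3 := inner_resolventError_approxResolvent_nonneg hT hc m f
  have h4 := inner_approxResolvent_self hT m f
  rw [real_inner_comm g f]
  change ⟪g, f⟫_ℝ = _ at h4
  change 0 ≤ ⟪_, g⟫_ℝ at h3
  rw [h1, h2]
  linarith

omit hT in
lemma norm_pow_apply_le (k : ℕ) (x : E) : ‖(T ^ k) x‖ ≤ ‖x‖ := by
  induction k with
  | zero => simp
  | succ k ih => rw [pow_succ', Module.End.mul_apply]; exact (hc _).trans ih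

/-- With `R` the approximate resolvent and `u = (1 - T) g`, positivity of `R` at `f - u` gives `2⟨R
u, f⟩ ≤ ⟨R f, f⟩ + ⟨R u, u⟩`. Since `R u` is `g` up to the error term, this is the claim. The error
in `⟨R u, u⟩` has a favourable sign, as `⟨z + T z, z - T z⟩ = ‖z‖² - ‖T z‖² ≥ 0`; only the one in
`⟨R u, f⟩` remains. -/
lemma variational_le (f g : E) (m : ℕ) :
    4 * ⟪f, g⟫_ℝ - 2 * ⟪g, g - T g⟫_ℝ ≤
      ‖f‖ ^ 2 + partialVar T f m + 2 * (‖(T ^ m) (f + T f)‖ * ‖g‖) := by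
  set u := g - T g with hu
  have e : approxResolvent T m u = g - resolventError T m g := by
    simpa [hu] using congrArg (fun A : Module.End ℝ E => A g) (approxResolvent_mul_one_sub T m)
  have h1 : ⟪f, g⟫_ℝ = ⟪f, approxResolvent T m u⟫_ℝ + ⟪resolventError T m g, f⟫_ℝ := by
    rw [e, inner_sub_right, real_inner_comm (resolventError T m g)]; ring
  have h2 : ⟪resolventError T m g, f⟫_ℝ ≤ 2⁻¹ * (‖(T ^ m) (f + T f)‖ * ‖g‖) := by
    rw [inner_resolventError hT, pow_add_apply_self, inner_one_add hT, ← pow_add_apply_self,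
      real_inner_comm]
    refine mul_le_mul_of_nonneg_left ((real_inner_le_norm _ _).trans ?_) (by norm_num)
    exact mul_le_mul_of_nonneg_left (norm_pow_apply_le hc m g) (norm_nonneg _)
  have h3 : ⟪approxResolvent T m u, u⟫_ℝ ≤ ⟪g, u⟫_ℝ := by
    have h5 : 0 ≤ ⟪resolventError T m g, u⟫_ℝ := by
      rw [inner_resolventError hT, hu, pow_add_apply_self, map_sub, ← Module.End.mul_apply (T ^ m),
        (Commute.pow_self T m).eq, Module.End.mul_apply]
      set z := (T ^ m) g
      have : ⟪z + T z, z - T z⟫_ℝ = ‖z‖ ^ 2 - ‖T z‖ ^ 2 := by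
        rw [inner_sub_right, inner_add_left, inner_add_left, real_inner_self_eq_norm_sq,
          real_inner_self_eq_norm_sq, real_inner_comm z (T z)]; ring
      rw [this]
      have := pow_le_pow_left₀ (norm_nonneg _) (hc z) 2
      linarith
    rw [e, inner_sub_left]; linarith
  clear_value u
  have h4 : 0 ≤ ⟪approxResolvent T m (f - u), f - u⟫_ℝ := by
    rw [inner_approxResolvent_self hT]
    exact mul_nonneg (by norm_num) (add_nonneg (sq_nonneg _)
      (Finset.sum_nonneg fun _ _ => sq_nonneg _))
  rw [map_sub, inner_sub_left, inner_sub_right, inner_sub_right, approxResolvent_symm hT m f u,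
    real_inner_comm f (approxResolvent T m u), inner_approxResolvent_self hT] at h4
  linarith

omit hT hc in
/-- The asymptotic variance `∑ₖ ‖Tᵏ (1 + T) f‖²`. -/
noncomputable def specVar (T : Module.End ℝ E) (f : E) : ℝ≥0∞ :=
  ∑' k, ENNReal.ofReal (‖(T ^ k) (f + T f)‖ ^ 2)

omit hT hc in
lemma ofReal_partialVar (f : E) (m : ℕ) : ENNReal.ofReal (partialVar T f m) =
    ∑ k ∈ Finset.range m, ENNReal.ofReal (‖(T ^ k) (f + T f)‖ ^ 2) :=
  ENNReal.ofReal_sum_of_nonneg fun _ _ => sq_nonneg _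

omit hT hc in
lemma partialVar_nonneg (f : E) (m : ℕ) : 0 ≤ partialVar T f m :=
  Finset.sum_nonneg fun _ _ => sq_nonneg _

omit hT hc in
lemma tendsto_partialVar (f : E) :
    Tendsto (fun m => ENNReal.ofReal (partialVar T f m)) atTop (𝓝 (specVar T f)) := by
  simp_rw [ofReal_partialVar]
  exact ENNReal.tendsto_nat_tsum _

/-- Variational formula for the asymptotic variance. -/
theorem specVar_add_norm_sq (f : E) :
    specVar T f + ENNReal.ofReal (‖f‖ ^ 2) =
      ⨆ g, ENNReal.ofReal (4 * ⟪f, g⟫_ℝ - 2 * ⟪g, g - T g⟫_ℝ) := by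
  have hlim : Tendsto (fun m => ENNReal.ofReal (‖f‖ ^ 2 + partialVar T f m)) atTop
      (𝓝 (specVar T f + ENNReal.ofReal (‖f‖ ^ 2))) := by
    simp_rw [ENNReal.ofReal_add (sq_nonneg ‖f‖) (partialVar_nonneg _ _)]
    rw [add_comm]
    exact (tendsto_partialVar f).const_add _
  apply le_antisymm
  · refine le_of_tendsto' hlim fun m => ?_
    exact le_iSup_of_le (approxResolvent T m f)
      (ENNReal.ofReal_le_ofReal (norm_sq_add_partialVar_le hT hc f m))
  · refine iSup_le fun g => ?_
    -- If the series converges, its terms tend to zero, which removes the error in `variational_le`.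
    by_cases hV : specVar T f = ∞
    · simp [hV]
    have h0 : Tendsto (fun m => ‖(T ^ m) (f + T f)‖ ^ 2) atTop (𝓝 0) := by
      have := (ENNReal.tendsto_toReal ENNReal.zero_ne_top).comp
        (ENNReal.tendsto_atTop_zero_of_tsum_ne_top hV)
      refine this.congr fun m => ?_
      simp
    have h1 : Tendsto (fun m => ‖(T ^ m) (f + T f)‖) atTop (𝓝 0) := by
      have := h0.sqrt
      simpa [Real.sqrt_sq] using this
    have h2 : Tendsto (fun m => ENNReal.ofReal (2 * (‖(T ^ m) (f + T f)‖ * ‖g‖))) atTop (𝓝 0) := by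
      have := (h1.mul_const ‖g‖).const_mul 2
      rw [zero_mul, mul_zero] at this
      simpa using ENNReal.tendsto_ofReal this
    have h3 := hlim.add h2
    rw [add_zero] at h3
    refine ge_of_tendsto' h3 fun m => ?_
    rw [← ENNReal.ofReal_add (add_nonneg (sq_nonneg _) (partialVar_nonneg _ _)) (by positivity)]
    exact ENNReal.ofReal_le_ofReal (variational_le hT hc f g m)

/-! ### Cesàro means of covariance sums -/

omit hc in
lemma partialVar_succ (f : E) (m : ℕ) :
    partialVar T f (m + 1) = partialVar T f m + (⟪f, (T ^ (2 * m)) f⟫_ℝ +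
      2 * ⟪f, (T ^ (2 * m + 1)) f⟫_ℝ + ⟪f, (T ^ (2 * m + 2)) f⟫_ℝ) := by
  rw [partialVar, Finset.sum_range_succ, ← partialVar, pow_add_apply_self, norm_add_sq_real]
  simp_rw [real_inner_comm _ f]
  rw [inner_pow_two_mul hT, show 2 * m + 1 = m + (m + 1) by ring, inner_pow_add hT,
    show 2 * m + 2 = (m + 1) + (m + 1) by ring, inner_pow_add hT, pow_succ' T m,
    Module.End.mul_apply, real_inner_self_eq_norm_sq, real_inner_self_eq_norm_sq]

-- Each squared norm covers three consecutive lags with weights 1, 2, 1. Neighbouring blocks share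
-- an even lag, so every lag gets weight 2 except the two endpoints.
omit hc in
lemma sum_covariances (f : E) (m : ℕ) :
    ⟪f, f⟫_ℝ + 2 * ∑ k ∈ Finset.Icc 1 (2 * m), ⟪f, (T ^ k) f⟫_ℝ =
      partialVar T f m + ⟪f, (T ^ (2 * m)) f⟫_ℝ := by
  induction m with
  | zero => simp [partialVar]
  | succ m ih =>
    rw [mul_add, mul_one, Finset.sum_Icc_succ_top (by omega), Finset.sum_Icc_succ_top (by omega),
      partialVar_succ hT]
    linarith

-- Write `c k = ⟨f, Tᵏ f⟩`. The inner sum exceeds the partial variance by `c (2m)` at `j = 2m` and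
-- by `-c (2m + 2)` at `j = 2m + 1`, so the corrections telescope over pairs.
omit hc in
lemma sum_sum_covariances (f : E) (m : ℕ) :
    ∑ j ∈ Finset.range (2 * m),
      (⟪f, f⟫_ℝ + 2 * ∑ k ∈ Finset.Icc 1 j, ⟪f, (T ^ k) f⟫_ℝ) =
      ∑ j ∈ Finset.range (2 * m), partialVar T f ((j + 1) / 2) +
        (‖f‖ ^ 2 - ⟪f, (T ^ (2 * m)) f⟫_ℝ) := by
  induction m with
  | zero => simp
  | succ m ih =>
    rw [mul_add, mul_one, Finset.sum_range_succ, Finset.sum_range_succ, Finset.sum_range_succ,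
      Finset.sum_range_succ, ih, Finset.sum_Icc_succ_top (by omega)]
    have h := sum_covariances hT f m
    rw [show (2 * m + 1) / 2 = m by omega, show (2 * m + 1 + 1) / 2 = m + 1 by omega,
      partialVar_succ hT]
    linarith

/-- Even-lag covariances are `‖Tᵐ f‖²`, between 0 and `‖f‖²`. The correction is therefore bounded in
`n` and vanishes after division by `n`. -/
lemma sum_sum_covariances_bounds (f : E) (n : ℕ) :
    ∃ e, 0 ≤ e ∧ e ≤ ‖f‖ ^ 2 ∧ ∑ j ∈ Finset.range n,
      (⟪f, f⟫_ℝ + 2 * ∑ k ∈ Finset.Icc 1 j, ⟪f, (T ^ k) f⟫_ℝ) =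
      ∑ j ∈ Finset.range n, partialVar T f ((j + 1) / 2) + e := by
  obtain ⟨m, rfl | rfl⟩ := Nat.even_or_odd' n
  · refine ⟨_, ?_, ?_, sum_sum_covariances hT f m⟩ <;>
    rw [real_inner_comm, inner_pow_two_mul hT, real_inner_self_eq_norm_sq]
    · have := pow_le_pow_left₀ (norm_nonneg _) (norm_pow_apply_le hc m f) 2
      linarith
    · linarith [sq_nonneg ‖(T ^ m) f‖]
  · refine ⟨‖f‖ ^ 2, sq_nonneg _, le_rfl, ?_⟩
    rw [Finset.sum_range_succ, Finset.sum_range_succ, sum_sum_covariances hT,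
      sum_covariances hT, show (2 * m + 1) / 2 = m by omega]
    ring

omit hT hc in
/-- Cesàro means of a monotone sequence converge to its limit, also when that limit is `∞`. -/
lemma tendsto_cesaro_of_monotone {u : ℕ → ℝ≥0∞} (hu : Monotone u) {l : ℝ≥0∞}
    (hl : Tendsto u atTop (𝓝 l)) :
    Tendsto (fun n : ℕ => (n : ℝ≥0∞)⁻¹ * ∑ j ∈ Finset.range n, u j) atTop (𝓝 l) := by
  refine tendsto_order.2 ⟨fun b hb => ?_, fun b hb => ?_⟩
  · obtain ⟨c, hbc, hcl⟩ := exists_between hb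
    obtain ⟨N, hN⟩ := (hl.eventually (lt_mem_nhds hcl)).exists
    have hc : c ≠ ∞ := hcl.ne_top
    -- Lower bound for the mean: drop the first `N` terms and bound the other `n - N` below by `c`.
    have h1 : Tendsto (fun n : ℕ => (1 - (N : ℝ≥0∞) * (n : ℝ≥0∞)⁻¹) * c) atTop (𝓝 c) := by
      have h2 : Tendsto (fun n : ℕ => (N : ℝ≥0∞) * (n : ℝ≥0∞)⁻¹) atTop (𝓝 0) := by
        simpa using ENNReal.Tendsto.const_mul ENNReal.tendsto_inv_nat_nhds_zero
          (Or.inr (ENNReal.natCast_ne_top N))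
      have h3 := ENNReal.Tendsto.sub (tendsto_const_nhds (x := (1 : ℝ≥0∞))) h2
        (Or.inl ENNReal.one_ne_top)
      simpa using ENNReal.Tendsto.mul_const h3 (Or.inr hc)
    filter_upwards [h1.eventually (lt_mem_nhds hbc), eventually_ge_atTop (N + 1)] with n hn hnN
    refine hn.trans_le ?_
    have hn0 : (n : ℝ≥0∞) ≠ 0 := by
      simp; omega
    have h4 : (1 - (N : ℝ≥0∞) * (n : ℝ≥0∞)⁻¹) = (n : ℝ≥0∞)⁻¹ * ((n - N : ℕ) : ℝ≥0∞) := by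
      rw [ENNReal.natCast_sub, ENNReal.mul_sub (fun _ _ => by simpa using hn0),
        ENNReal.inv_mul_cancel hn0 (ENNReal.natCast_ne_top n), mul_comm]
    rw [h4, mul_assoc]
    gcongr
    calc ((n - N : ℕ) : ℝ≥0∞) * c = ∑ j ∈ Finset.Ico N n, c := by simp
      _ ≤ ∑ j ∈ Finset.Ico N n, u j :=
        Finset.sum_le_sum fun j hj => hN.le.trans (hu (Finset.mem_Ico.1 hj).1)
      _ ≤ ∑ j ∈ Finset.range n, u j := by
        refine Finset.sum_le_sum_of_subset fun j hj => ?_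
        exact Finset.mem_range.2 (Finset.mem_Ico.1 hj).2
  · refine Eventually.of_forall fun n => lt_of_le_of_lt ?_ hb
    calc (n : ℝ≥0∞)⁻¹ * ∑ j ∈ Finset.range n, u j ≤ (n : ℝ≥0∞)⁻¹ * ∑ j ∈ Finset.range n, l := by
          gcongr with j; exact hu.ge_of_tendsto hl j
      _ ≤ l := by
        rw [Finset.sum_const, Finset.card_range, nsmul_eq_mul, ← mul_assoc]
        exact mul_le_of_le_one_left' (ENNReal.inv_mul_le_one _)

theorem tendsto_mean_covariances (f : E) :
    Tendsto (fun n : ℕ => (n : ℝ≥0∞)⁻¹ * ENNReal.ofReal (∑ j ∈ Finset.range n,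
      (⟪f, f⟫_ℝ + 2 * ∑ k ∈ Finset.Icc 1 j, ⟪f, (T ^ k) f⟫_ℝ))) atTop (𝓝 (specVar T f)) := by
  choose e he0 he1 he using sum_sum_covariances_bounds hT hc f
  have hdiv : Tendsto (fun j : ℕ => (j + 1) / 2) atTop atTop :=
    tendsto_atTop.2 fun b => by
      filter_upwards [eventually_ge_atTop (2 * b)] with j hj
      omega
  have hmono : Monotone fun j : ℕ => ENNReal.ofReal (partialVar T f ((j + 1) / 2)) := by
    intro i j hij
    refine ENNReal.ofReal_le_ofReal (Finset.sum_le_sum_of_subset_of_nonneg ?_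
      fun _ _ _ => sq_nonneg _)
    exact Finset.range_subset_range.2 (by omega)
  have h1 := tendsto_cesaro_of_monotone hmono ((tendsto_partialVar (T := T) f).comp hdiv)
  have h2 : Tendsto (fun n : ℕ => (n : ℝ≥0∞)⁻¹ * ENNReal.ofReal (e n)) atTop (𝓝 0) := by
    have h3 : Tendsto (fun n : ℕ => (n : ℝ≥0∞)⁻¹ * ENNReal.ofReal (‖f‖ ^ 2)) atTop (𝓝 0) := by
      rw [← zero_mul (ENNReal.ofReal (‖f‖ ^ 2))]
      exact ENNReal.Tendsto.mul_const ENNReal.tendsto_inv_nat_nhds_zero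
        (Or.inr ENNReal.ofReal_ne_top)
    refine tendsto_of_tendsto_of_tendsto_of_le_of_le tendsto_const_nhds h3 (fun _ => zero_le)
      fun n => ?_
    exact mul_le_mul_right (ENNReal.ofReal_le_ofReal (he1 n)) _
  have h4 := h1.add h2
  rw [add_zero] at h4
  refine h4.congr fun n => ?_
  rw [he, ENNReal.ofReal_add (Finset.sum_nonneg fun _ _ => partialVar_nonneg _ _) (he0 n),
    ENNReal.ofReal_sum_of_nonneg fun _ _ => partialVar_nonneg _ _, mul_add]

omit hT hc in
/-- The second moment of the partial sums of a stationary sequence. -/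
lemma norm_sum_sq_of_stationary {G : ℕ → E} {a : ℕ → ℝ} (hG : ∀ i k, ⟪G i, G (i + k)⟫_ℝ = a k)
    (n : ℕ) : ‖∑ k ∈ Finset.Icc 1 n, G k‖ ^ 2 =
      ∑ j ∈ Finset.range n, (a 0 + 2 * ∑ k ∈ Finset.Icc 1 j, a k) := by
  induction n with
  | zero => simp
  | succ n ih =>
    rw [Finset.sum_Icc_succ_top (by omega), norm_add_sq_real, ih, Finset.sum_range_succ, sum_inner]
    have h1 : ∑ k ∈ Finset.Icc 1 n, ⟪G k, G (n + 1)⟫_ℝ = ∑ k ∈ Finset.Icc 1 n, a k := by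
      refine Finset.sum_nbij' (fun k => n + 1 - k) (fun k => n + 1 - k) ?_ ?_ ?_ ?_ ?_ <;>
        intro k hk <;> rw [Finset.mem_Icc] at hk
      · exact Finset.mem_Icc.2 (by omega)
      · exact Finset.mem_Icc.2 (by omega)
      · omega
      · omega
      · rw [← hG k (n + 1 - k), Nat.add_sub_of_le (by omega)]
    rw [h1, ← real_inner_self_eq_norm_sq, ← hG (n + 1) 0]
    simp only [add_zero]
    ring

end Hilbert

/-! ### The Markov operator on `L²(π)` and the stationary chain -/

section Markov

open scoped InnerProductSpace

variable {X : Type*} [MeasurableSpace X] {K : Kernel X X} [IsMarkovKernel K]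
  {π : Measure X} [IsProbabilityMeasure π]

lemma measurePreserving_fst : MeasurePreserving Prod.fst (π ⊗ₘ K) π :=
  ⟨measurable_fst, Measure.fst_compProd π K⟩

lemma measurePreserving_snd (hK : Kernel.Invariant K π) :
    MeasurePreserving Prod.snd (π ⊗ₘ K) π :=
  ⟨measurable_snd, (Measure.snd_compProd π K).trans hK⟩

lemma measurePreserving_swap (hK : Kernel.IsReversible K π) :
    MeasurePreserving Prod.swap (π ⊗ₘ K) (π ⊗ₘ K) := by
  refine ⟨measurable_swap, Measure.ext_prod fun {s t} hs ht => ?_⟩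
  rw [Measure.map_apply measurable_swap (hs.prod ht), Set.preimage_swap_prod,
    Measure.compProd_apply_prod ht hs, Measure.compProd_apply_prod hs ht, hK ht hs]

/-- The Markov operator of a kernel with invariant probability `π`, acting on `L²(π)`. -/
noncomputable def markovOp (hK : Kernel.Invariant K π) : Module.End ℝ (Lp ℝ 2 π) :=
  (ContinuousLinearMap.adjoint
      (Lp.compMeasurePreservingₗᵢ ℝ Prod.fst
        (measurePreserving_fst (K := K) (π := π))).toContinuousLinearMap).toLinearMap ∘ₗ
    (Lp.compMeasurePreservingₗᵢ ℝ Prod.snd (measurePreserving_snd hK)).toLinearMap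

lemma inner_eq_integral {Ω : Type*} [MeasurableSpace Ω] {P : Measure Ω} {u v : Lp ℝ 2 P}
    {f g : Ω → ℝ} (hf : u =ᵐ[P] f) (hg : v =ᵐ[P] g) : ⟪u, v⟫_ℝ = ∫ x, f x * g x ∂P := by
  rw [L2.inner_def]
  refine integral_congr_ae ?_
  filter_upwards [hf, hg] with x h1 h2
  rw [← h1, ← h2, real_inner_eq_re_inner, RCLike.inner_apply]
  simp [mul_comm]

lemma inner_markovOp (hK : Kernel.Invariant K π) (u v : Lp ℝ 2 π) :
    ⟪u, markovOp hK v⟫_ℝ = ∫ p, u p.1 * v p.2 ∂(π ⊗ₘ K) := by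
  rw [markovOp, LinearMap.comp_apply, ContinuousLinearMap.coe_coe,
    ContinuousLinearMap.adjoint_inner_right]
  exact inner_eq_integral (Lp.coeFn_compMeasurePreserving _ _) (Lp.coeFn_compMeasurePreserving _ _)

/-- The pairing is an integral against the joint law of two consecutive states, and reversibility is
invariance of that law under the swap. -/
lemma markovOp_isSymmetric (hK : Kernel.IsReversible K π) :
    (markovOp hK.invariant).IsSymmetric := by
  intro u v
  rw [real_inner_comm, inner_markovOp, inner_markovOp]
  have h := (measurePreserving_swap hK).integral_comp' (f := MeasurableEquiv.prodComm)
    (fun p : X × X => u p.1 * v p.2)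
  rw [← h]
  exact integral_congr_ae (Eventually.of_forall fun p => mul_comm _ _)

lemma norm_markovOp_le (hK : Kernel.Invariant K π) (u : Lp ℝ 2 π) : ‖markovOp hK u‖ ≤ ‖u‖ := by
  set I := (Lp.compMeasurePreservingₗᵢ (E := ℝ) (p := 2) ℝ Prod.fst
        (measurePreserving_fst (K := K) (π := π)))
  set J := (Lp.compMeasurePreservingₗᵢ (E := ℝ) (p := 2) ℝ Prod.snd (measurePreserving_snd hK))
  calc ‖markovOp hK u‖ = ‖ContinuousLinearMap.adjoint I.toContinuousLinearMap (J u)‖ := rfl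
    _ ≤ ‖ContinuousLinearMap.adjoint I.toContinuousLinearMap‖ * ‖J u‖ :=
      ContinuousLinearMap.le_opNorm _ _
    _ ≤ 1 * ‖u‖ := by
      rw [LinearIsometryEquiv.norm_map, J.norm_map]
      gcongr
      exact I.norm_toContinuousLinearMap_le
    _ = ‖u‖ := one_mul _

lemma memLp_snd (hK : Kernel.Invariant K π) (v : Lp ℝ 2 π) :
    MemLp (fun p : X × X => v p.2) 2 (π ⊗ₘ K) :=
  (Lp.memLp v).comp_measurePreserving (measurePreserving_snd hK)

/-- Both sides have the same integral over every measurable set, by pairing with indicators. -/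
lemma markovOp_ae_eq (hK : Kernel.Invariant K π) (v : Lp ℝ 2 π) :
    markovOp hK v =ᵐ[π] fun x => ∫ y, v y ∂(K x) := by
  have hint : Integrable (fun p : X × X => v p.2) (π ⊗ₘ K) :=
    (memLp_snd hK v).integrable one_le_two
  refine Integrable.ae_eq_of_forall_setIntegral_eq _ _
    ((Lp.memLp _).integrable one_le_two) (Integrable.integral_compProd hint) fun s hs _ => ?_
  have h1 := inner_markovOp hK (indicatorConstLp 2 hs (measure_ne_top π s) (1 : ℝ)) v
  rw [L2.inner_indicatorConstLp_one] at h1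
  rw [h1]
  have h2 : ∀ᵐ p ∂(π ⊗ₘ K), indicatorConstLp 2 hs (measure_ne_top π s) (1 : ℝ) p.1 * v p.2 =
      (s ×ˢ Set.univ).indicator (fun p : X × X => v p.2) p := by
    filter_upwards [measurePreserving_fst.quasiMeasurePreserving.ae
      (indicatorConstLp_coeFn (p := 2) (hs := hs) (hμs := measure_ne_top π s) (c := (1 : ℝ)))]
      with p hp
    rw [hp]
    by_cases h : p.1 ∈ s <;> simp [Set.indicator, h]
  rw [integral_congr_ae h2, integral_indicator (hs.prod MeasurableSet.univ),
    Measure.setIntegral_compProd hs MeasurableSet.univ hint.integrableOn]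
  simp

instance (μ₀ : Measure X) [IsProbabilityMeasure μ₀] : IsProbabilityMeasure (chainLaw K μ₀) := by
  unfold chainLaw; infer_instance

lemma map_frestrictLe_chainLaw (n : ℕ) :
    (chainLaw K π).map (Preorder.frestrictLe n) ⊗ₘ stepKernel K n =
      (chainLaw K π).map (fun ω => (Preorder.frestrictLe n ω, ω (n + 1))) :=
  Kernel.map_frestrictLe_trajMeasure_compProd_eq_map_trajMeasure

omit [IsProbabilityMeasure π] in
lemma map_eval_zero_chainLaw : (chainLaw K π).map (fun ω => ω 0) = π := by
  have h0 : (fun ω : ℕ → X => ω 0) =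
      (MeasurableEquiv.piUnique (fun _ : Finset.Iic 0 => X)) ∘ Preorder.frestrictLe 0 := rfl
  rw [h0, ← Measure.map_map (by fun_prop) (by fun_prop), chainLaw, Kernel.trajMeasure,
    Measure.map_comp _ _ (by fun_prop), Kernel.traj_map_frestrictLe, Kernel.partialTraj_self,
    Measure.id_comp]
  exact MeasurableEquiv.map_map_symm _

lemma measurePreserving_eval (hK : Kernel.Invariant K π) (n : ℕ) :
    MeasurePreserving (fun ω : ℕ → X => ω n) (chainLaw K π) π := by
  refine ⟨measurable_pi_apply n, ?_⟩
  induction n with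
  | zero => exact map_eval_zero_chainLaw
  | succ n ih =>
    have h1 : (chainLaw K π).map (fun ω => ω (n + 1)) =
        ((chainLaw K π).map (Preorder.frestrictLe n) ⊗ₘ stepKernel K n).map Prod.snd := by
      rw [map_frestrictLe_chainLaw, Measure.map_map measurable_snd (by fun_prop)]
      rfl
    have h2 : ((chainLaw K π).map (Preorder.frestrictLe n)).bind (stepKernel K n) = π.bind K := by
      conv_rhs => rw [← ih]
      ext s hs
      rw [Measure.bind_apply hs (Kernel.aemeasurable _), Measure.bind_apply hs (Kernel.aemeasurable _),
        lintegral_map (Kernel.measurable_coe _ hs) (by fun_prop),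
        lintegral_map (Kernel.measurable_coe _ hs) (by fun_prop)]
      rfl
    rw [h1]
    exact (Measure.snd_compProd _ _).trans (h2.trans hK)

/-- The Markov property, in terms of covariances. -/
lemma integral_mul_succ (hK : Kernel.Invariant K π) (u v : Lp ℝ 2 π) {j n : ℕ} (hj : j ≤ n) :
    ∫ ω, u (ω j) * v (ω (n + 1)) ∂(chainLaw K π) =
      ∫ ω, u (ω j) * markovOp hK v (ω n) ∂(chainLaw K π) := by
  have hv : StronglyMeasurable v := Lp.stronglyMeasurable v
  have hu : StronglyMeasurable u := Lp.stronglyMeasurable u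
  let F : (Finset.Iic n → X) × X → ℝ := fun q => u (q.1 ⟨j, Finset.mem_Iic.2 hj⟩) * v q.2
  have hF : StronglyMeasurable F :=
    (hu.comp_measurable (by fun_prop)).mul (hv.comp_measurable measurable_snd)
  have hm : Measurable fun ω : ℕ → X => (Preorder.frestrictLe (π := fun _ => X) n ω, ω (n + 1)) :=
    by fun_prop
  have hint : Integrable F
      ((chainLaw K π).map (Preorder.frestrictLe n) ⊗ₘ stepKernel K n) := by
    rw [map_frestrictLe_chainLaw, integrable_map_measure hF.aestronglyMeasurable hm.aemeasurable]
    exact ((Lp.memLp u).comp_measurePreserving (measurePreserving_eval hK j)).integrable_mul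
      ((Lp.memLp v).comp_measurePreserving (measurePreserving_eval hK (n + 1)))
  have h1 : ∫ ω, u (ω j) * v (ω (n + 1)) ∂(chainLaw K π) =
      ∫ q, F q ∂((chainLaw K π).map (Preorder.frestrictLe n) ⊗ₘ stepKernel K n) := by
    rw [map_frestrictLe_chainLaw, integral_map hm.aemeasurable hF.aestronglyMeasurable]
    rfl
  -- Disintegrate over the history up to time `n`: the factor at time `j ≤ n` is fixed, and the next
  -- state has law `K (ω n)`.
  rw [h1, Measure.integral_compProd hint,
    integral_map (by fun_prop) hF.integral_kernel_prod_right'.aestronglyMeasurable]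
  refine integral_congr_ae ?_
  filter_upwards [(measurePreserving_eval hK n).quasiMeasurePreserving.ae (markovOp_ae_eq hK v)]
    with ω hω
  rw [hω, ← integral_const_mul]
  rfl

lemma integral_mul_add (hK : Kernel.Invariant K π) (u v : Lp ℝ 2 π) (j k : ℕ) :
    ∫ ω, u (ω j) * v (ω (j + k)) ∂(chainLaw K π) = ⟪u, (markovOp hK ^ k) v⟫_ℝ := by
  induction k generalizing v with
  | zero =>
    rw [pow_zero, Module.End.one_apply, inner_eq_integral (ae_eq_refl _) (ae_eq_refl _)]
    have h := integral_map (μ := chainLaw K π) (measurePreserving_eval hK j).measurable.aemeasurable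
      ((Lp.stronglyMeasurable u).mul (Lp.stronglyMeasurable v)).aestronglyMeasurable
    rw [(measurePreserving_eval hK j).map_eq] at h
    exact h.symm
  | succ k ih =>
    rw [← add_assoc, integral_mul_succ hK u v (Nat.le_add_right j k), ih, pow_succ,
      Module.End.mul_apply]

end Markov

/-! ### Asymptotic variance of a reversible chain -/

section Variance

open scoped InnerProductSpace

variable {X : Type*} [MeasurableSpace X] {K : Kernel X X} [IsMarkovKernel K]
  {π : Measure X} [IsProbabilityMeasure π]

lemma memLp_centered {f : X → ℝ} (hf : MemLp f 2 π) :
    MemLp (fun x => f x - ∫ y, f y ∂π) 2 π :=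
  hf.sub (memLp_const _)

lemma evariance_eq_norm_sq {f : X → ℝ} (hf : MemLp f 2 π) :
    evariance f π = ENNReal.ofReal (‖(memLp_centered hf).toLp _‖ ^ 2) := by
  rw [← real_inner_self_eq_norm_sq,
    inner_eq_integral (memLp_centered hf).coeFn_toLp (memLp_centered hf).coeFn_toLp,
    ofReal_integral_eq_lintegral_ofReal, evariance]
  · refine lintegral_congr fun x => ?_
    rw [← sq, ← Real.enorm_of_nonneg (sq_nonneg _), enorm_pow]
  · simpa only [← sq] using (memLp_centered hf).integrable_sq
  · exact Eventually.of_forall fun x => mul_self_nonneg _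

lemma lintegral_sum_sq_chain (hK : Kernel.Invariant K π) {f : X → ℝ} (hf : MemLp f 2 π) (n : ℕ) :
    ∫⁻ ω, ENNReal.ofReal ((∑ k ∈ Finset.Icc 1 n, f (ω k)) ^ 2) ∂(chainLaw K π) =
      ENNReal.ofReal (∑ j ∈ Finset.range n, (⟪hf.toLp f, hf.toLp f⟫_ℝ +
        2 * ∑ k ∈ Finset.Icc 1 j, ⟪hf.toLp f, (markovOp hK ^ k) (hf.toLp f)⟫_ℝ)) := by
  set F := hf.toLp f with hF
  let G : ℕ → Lp ℝ 2 (chainLaw K π) := fun k =>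
    Lp.compMeasurePreserving (fun ω : ℕ → X => ω k) (measurePreserving_eval hK k) F
  have hG (k : ℕ) : G k =ᵐ[chainLaw K π] fun ω => F (ω k) := Lp.coeFn_compMeasurePreserving _ _
  have hcov (i k : ℕ) : ⟪G i, G (i + k)⟫_ℝ = ⟪F, (markovOp hK ^ k) F⟫_ℝ := by
    rw [inner_eq_integral (hG i) (hG (i + k)), integral_mul_add hK]
  have hS : (∑ k ∈ Finset.Icc 1 n, G k : Lp ℝ 2 (chainLaw K π)) =ᵐ[chainLaw K π]
      fun ω => ∑ k ∈ Finset.Icc 1 n, f (ω k) := by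
    have hGf (k : ℕ) : G k =ᵐ[chainLaw K π] fun ω => f (ω k) :=
      (hG k).trans ((measurePreserving_eval hK k).quasiMeasurePreserving.ae hf.coeFn_toLp)
    induction Finset.Icc 1 n using Finset.induction_on with
    | empty =>
      simp only [Finset.sum_empty]
      exact Lp.coeFn_zero ℝ 2 (chainLaw K π)
    | insert a s ha ih =>
      rw [Finset.sum_insert ha]
      filter_upwards [Lp.coeFn_add (G a) (∑ k ∈ s, G k), ih, hGf a] with ω h1 h2 h3
      rw [h1, Pi.add_apply, h2, h3, Finset.sum_insert ha]
  have h1 := norm_sum_sq_of_stationary hcov n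
  rw [pow_zero, Module.End.one_apply] at h1
  rw [← h1, ← real_inner_self_eq_norm_sq, inner_eq_integral hS hS,
    ofReal_integral_eq_lintegral_ofReal]
  · simp_rw [sq]
  · have : MemLp (fun ω : ℕ → X => ∑ k ∈ Finset.Icc 1 n, f (ω k)) 2 (chainLaw K π) :=
      (memLp_congr_ae hS).1 (Lp.memLp _)
    simpa only [← sq] using this.integrable_sq
  · exact Eventually.of_forall fun x => mul_self_nonneg _

lemma dirichletForm_eq_inner (hK : Kernel.Invariant K π) {g : X → ℝ} (hg : MemLp g 2 π) :
    dirichletForm K π g = ⟪hg.toLp g, hg.toLp g - markovOp hK (hg.toLp g)⟫_ℝ := by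
  refine (inner_eq_integral hg.coeFn_toLp ?_).symm
  have h := Measure.ae_ae_of_ae_compProd
    ((measurePreserving_snd (K := K) hK).quasiMeasurePreserving.ae hg.coeFn_toLp)
  filter_upwards [Lp.coeFn_sub (hg.toLp g) (markovOp hK (hg.toLp g)), hg.coeFn_toLp,
    markovOp_ae_eq hK (hg.toLp g), h] with x h1 h2 h3 h4
  rw [h1, Pi.sub_apply, h2, h3, integral_congr_ae h4]

omit [IsMarkovKernel K] [IsProbabilityMeasure π] in
lemma dirichletForm_const_mul (c : ℝ) (g : X → ℝ) :
    dirichletForm K π (fun x => c * g x) = c ^ 2 * dirichletForm K π g := by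
  simp only [dirichletForm]
  rw [← integral_const_mul]
  congr 1 with x
  rw [integral_const_mul]
  ring

/-- For a reversible kernel the asymptotic variance exists, and it is given by a variational
formula over `L²(π)`. -/
theorem exists_hasAsymptoticVariance (hK : Kernel.IsReversible K π) {f : X → ℝ}
    (hf : MemLp f 2 π) :
    ∃ v, HasAsymptoticVariance K π f v ∧ v + evariance f π =
      ⨆ (g : X → ℝ) (_ : MemLp g 2 π), ENNReal.ofReal
        (4 * ∫ x, (f x - ∫ y, f y ∂π) * g x ∂π - 2 * dirichletForm K π g) := by
  have hf0 := memLp_centered hf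
  refine ⟨specVar (markovOp hK.invariant) (hf0.toLp _), ?_, ?_⟩
  · unfold HasAsymptoticVariance
    simp_rw [lintegral_sum_sq_chain hK.invariant hf0]
    exact tendsto_mean_covariances (markovOp_isSymmetric hK) (norm_markovOp_le _) _
  · rw [evariance_eq_norm_sq hf,
      specVar_add_norm_sq (markovOp_isSymmetric hK) (norm_markovOp_le _)]
    have key {g : X → ℝ} (hg : MemLp g 2 π) :
        ENNReal.ofReal (4 * ∫ x, (f x - ∫ y, f y ∂π) * g x ∂π - 2 * dirichletForm K π g) =
        ENNReal.ofReal (4 * ⟪hf0.toLp _, hg.toLp g⟫_ℝ -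
          2 * ⟪hg.toLp g, hg.toLp g - markovOp hK.invariant (hg.toLp g)⟫_ℝ) := by
      rw [dirichletForm_eq_inner hK.invariant hg, inner_eq_integral hf0.coeFn_toLp hg.coeFn_toLp]
    apply le_antisymm
    · refine iSup_le fun g => le_iSup₂_of_le (g : X → ℝ) (Lp.memLp g) ?_
      rw [key (Lp.memLp g), Lp.toLp_coeFn]
    · exact iSup₂_le fun g hg => (key hg).le.trans (le_iSup_of_le (hg.toLp g) le_rfl)

end Variance

/-! ### Change of measure by a bounded density -/

section Comparison

variable {X : Type*} [MeasurableSpace X] {μ : Measure X} {w : X → ℝ≥0}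

lemma integral_density_mul (hw : Measurable w) (f g : X → ℝ) :
    ∫ x, f x * g x ∂(μ.withDensity fun x => (w x : ℝ≥0∞)) = ∫ x, (w x * f x) * g x ∂μ := by
  rw [integral_withDensity_eq_integral_smul hw]
  simp only [NNReal.smul_def, smul_eq_mul, mul_assoc]

lemma memLp_withDensity_of_le {c : ℝ≥0} (hc : ∀ᵐ x ∂μ, w x ≤ c)
    {g : X → ℝ} (hg : MemLp g 2 μ) : MemLp g 2 (μ.withDensity fun x => (w x : ℝ≥0∞)) := by
  refine hg.of_measure_le_smul (c := (c : ℝ≥0∞)) ENNReal.coe_ne_top ?_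
  rw [← withDensity_const]
  exact withDensity_mono (hc.mono fun x hx => ENNReal.coe_le_coe.2 hx)

lemma memLp_of_withDensity_of_le {c : ℝ≥0} (hc0 : c ≠ 0) (hc : ∀ᵐ x ∂μ, c ≤ w x)
    {g : X → ℝ} (hg : MemLp g 2 (μ.withDensity fun x => (w x : ℝ≥0∞))) : MemLp g 2 μ := by
  have hc1 : (c : ℝ≥0∞) ≠ 0 := by exact_mod_cast hc0
  refine hg.of_measure_le_smul (c := (c : ℝ≥0∞)⁻¹) (ENNReal.inv_ne_top.2 hc1) ?_
  calc μ = (c : ℝ≥0∞)⁻¹ • (c : ℝ≥0∞) • μ := by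
        rw [smul_smul, ENNReal.inv_mul_cancel hc1 ENNReal.coe_ne_top, one_smul]
    _ ≤ _ := by
      gcongr
      rw [← withDensity_const]
      exact withDensity_mono (hc.mono fun x hx => ENNReal.coe_le_coe.2 hx)

/-- Pointwise `(w f)² ≤ c · w f²`, and `w f²` is `μ`-integrable because `f ∈ L²(ν)`. -/
lemma memLp_density_mul (hw : Measurable w) {c : ℝ≥0} (hc : ∀ᵐ x ∂μ, w x ≤ c)
    {f : X → ℝ} (hf : MemLp f 2 (μ.withDensity fun x => (w x : ℝ≥0∞))) :
    MemLp (fun x => (w x : ℝ) * f x) 2 μ := by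
  have hm : AEStronglyMeasurable (fun x => (w x : ℝ) * f x) μ := by
    have := (aestronglyMeasurable_withDensity_iff hw).1 hf.1
    simpa [NNReal.smul_def] using this
  rw [memLp_two_iff_integrable_sq hm]
  have h1 : Integrable (fun x => (w x : ℝ) * f x ^ 2) μ := by
    have := (integrable_withDensity_iff_integrable_smul hw).1 hf.integrable_sq
    simpa [NNReal.smul_def] using this
  refine (h1.const_mul (c : ℝ)).mono' (hm.pow 2) ?_
  filter_upwards [hc] with x hx
  have hx' : (w x : ℝ) ≤ c := by exact_mod_cast hx
  rw [Real.norm_of_nonneg (sq_nonneg _), mul_pow, sq (w x : ℝ), mul_assoc]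
  exact mul_le_mul_of_nonneg_right hx' (mul_nonneg (w x).2 (sq_nonneg _))

end Comparison

end QuasiPeskun

/-! ### The comparison theorem -/

theorem mainTheorem3 {X : Type*} [MeasurableSpace X]
    (μ ν : Measure X) [IsProbabilityMeasure μ] [IsProbabilityMeasure ν]
    (w : X → ℝ≥0) (hw : Measurable w) (hν : ν = μ.withDensity (fun x => (w x : ℝ≥0∞)))
    (K L : Kernel X X) [IsMarkovKernel K] [IsMarkovKernel L]
    (hKrev : Kernel.IsReversible K μ) (hLrev : Kernel.IsReversible L ν)
    (hK : QuasiPeskun.IsHarrisErgodic K μ) (hL : QuasiPeskun.IsHarrisErgodic L ν)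
    (cLow cUp : ℝ≥0)
    (hE : ∀ g : X → ℝ, MemLp g 2 μ →
      (cLow : ℝ) * QuasiPeskun.dirichletForm K μ g ≤ QuasiPeskun.dirichletForm L ν g ∧
      QuasiPeskun.dirichletForm L ν g ≤ (cUp : ℝ) * QuasiPeskun.dirichletForm K μ g)
    (hc : ∀ᵐ x ∂μ, cLow ≤ w x ∧ w x ≤ cUp)
    (φ : X → ℝ) (hφ : MemLp φ 2 ν) :
    ∃ vK vL : ℝ≥0∞,
      QuasiPeskun.HasAsymptoticVariance K μ (fun x => (w x : ℝ) * (φ x - ∫ y, φ y ∂ν)) vK ∧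
      QuasiPeskun.HasAsymptoticVariance L ν φ vL ∧
      vK + evariance (fun x => (w x : ℝ) * (φ x - ∫ y, φ y ∂ν)) μ
        ≤ (cUp : ℝ≥0∞) * (vL + evariance φ ν) ∧
      (cLow : ℝ≥0∞) * (vL + evariance φ ν)
        ≤ vK + evariance (fun x => (w x : ℝ) * (φ x - ∫ y, φ y ∂ν)) μ := by
  subst hν
  set ν := μ.withDensity (fun x => (w x : ℝ≥0∞)) with hν
  have hcl : ∀ᵐ x ∂μ, cLow ≤ w x := hc.mono fun _ h => h.1
  have hcu : ∀ᵐ x ∂μ, w x ≤ cUp := hc.mono fun _ h => h.2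
  have hφ0 := QuasiPeskun.memLp_centered hφ
  obtain ⟨vK, hvK, eK⟩ := QuasiPeskun.exists_hasAsymptoticVariance hKrev
    (QuasiPeskun.memLp_density_mul hw hcu hφ0)
  obtain ⟨vL, hvL, eL⟩ := QuasiPeskun.exists_hasAsymptoticVariance hLrev hφ
  -- The function `w φ̄` is already `μ`-centred, so the linear term for `K` becomes exactly that for
  -- `L`.
  have hmean : ∫ x, (w x : ℝ) * (φ x - ∫ y, φ y ∂ν) ∂μ = 0 := by
    have h := QuasiPeskun.integral_density_mul (μ := μ) hw (fun x => φ x - ∫ y, φ y ∂ν)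
      (fun _ => 1)
    simp only [mul_one] at h
    rw [← h, ← hν, integral_sub (hφ.integrable one_le_two) (integrable_const _)]
    simp
  simp only [hmean, sub_zero, ← QuasiPeskun.integral_density_mul hw, ← hν] at eK
  refine ⟨vK, vL, hvK, hvL, ?_, ?_⟩
  -- If `cUp` vanished then so would `ν`, which has mass one.
  · have hcUp : 0 < cUp := by
      refine pos_iff_ne_zero.2 fun h0 => ?_
      have h1 : ν Set.univ = 0 := by
        rw [hν, withDensity_apply _ MeasurableSet.univ, Measure.restrict_univ]
        refine (lintegral_congr_ae (hcu.mono fun x hx => ?_)).trans lintegral_zero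
        simpa [h0] using hx
      simp at h1
    have hpos : (0 : ℝ) < cUp := hcUp
    rw [eK]
    refine iSup₂_le fun g hg => ?_
    -- Testing `L` with `g / cUp` and multiplying by `cUp` leaves the linear term unchanged and
    -- divides the Dirichlet form by `cUp`, so that it is at most that of `K`.
    have hg' : MemLp (fun x => (cUp : ℝ)⁻¹ * g x) 2 ν :=
      (QuasiPeskun.memLp_withDensity_of_le hcu hg).const_mul _
    have h1 : ENNReal.ofReal (4 * ∫ x, (φ x - ∫ y, φ y ∂ν) * ((cUp : ℝ)⁻¹ * g x) ∂ν -
        2 * QuasiPeskun.dirichletForm L ν (fun x => (cUp : ℝ)⁻¹ * g x)) ≤ vL + evariance φ ν := by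
      rw [eL]
      exact le_iSup_of_le (fun x => (cUp : ℝ)⁻¹ * g x) (le_iSup_of_le hg' le_rfl)
    refine le_trans ?_ (mul_le_mul_right h1 _)
    rw [← ENNReal.ofReal_coe_nnreal, ← ENNReal.ofReal_mul cUp.coe_nonneg]
    refine ENNReal.ofReal_le_ofReal ?_
    simp only [QuasiPeskun.dirichletForm_const_mul, mul_left_comm _ (cUp : ℝ)⁻¹,
      integral_const_mul]
    have h2 : (cUp : ℝ)⁻¹ * QuasiPeskun.dirichletForm L ν g ≤ QuasiPeskun.dirichletForm K μ g :=
      (inv_mul_le_iff₀ hpos).2 (hE g hg).2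
    have h3 (a b : ℝ) : (cUp : ℝ) * (4 * ((cUp : ℝ)⁻¹ * a) - 2 * ((cUp : ℝ)⁻¹ ^ 2 * b)) =
        4 * a - 2 * ((cUp : ℝ)⁻¹ * b) := by
      field_simp
    rw [← mul_left_comm, h3]
    linarith
  -- For `cLow = 0` the left side is zero even if the variance is infinite. Otherwise `w` is bounded
  -- below, so `L²(ν)` test functions lie in `L²(μ)`.
  · rcases eq_or_ne cLow 0 with rfl | h0
    · simp
    rw [eL, eK]
    simp only [ENNReal.mul_iSup]
    refine iSup₂_le fun g hg => ?_
    -- Testing `K` with `cLow * g` gives the Dirichlet term `cLow² 𝓔_K(g) ≤ cLow 𝓔_L(g)`, matching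
    -- the factor `cLow` of the linear term.
    have hg' : MemLp (fun x => (cLow : ℝ) * g x) 2 μ :=
      (QuasiPeskun.memLp_of_withDensity_of_le h0 hcl hg).const_mul _
    refine le_trans ?_ (le_iSup_of_le (fun x => (cLow : ℝ) * g x) (le_iSup_of_le hg' le_rfl))
    rw [← ENNReal.ofReal_coe_nnreal, ← ENNReal.ofReal_mul cLow.coe_nonneg]
    refine ENNReal.ofReal_le_ofReal ?_
    have h2 := mul_le_mul_of_nonneg_left
      (hE g (QuasiPeskun.memLp_of_withDensity_of_le h0 hcl hg)).1 cLow.coe_nonneg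
    simp only [QuasiPeskun.dirichletForm_const_mul, mul_left_comm _ (cLow : ℝ),
      integral_const_mul]
    linarith
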